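/- Let $F$ be a field of characteristic $0$, let $n\ge 2$, let $X=\{x_1,x_2,\dots\}$ be a countable set of noncommuting indeterminates, and let $M_n(F)*F\langle X\rangle$ be the free product over $F$ of the unital algebras $M_n(F)$ and $F\langle X\rangle$. An element $f=f(x_1,\dots,x_k)$ of it is a generalized polynomial identity (GPI) of $M_n(F)$ if $f(b_1,\dots,b_k)=0$ for all $b_1,\dots,b_k\in M_n(F)$. A (two-sided) ideal $I$ of $M_n(F)*F\langle X\rangle$ is a T-ideal if $f(x_1,\dots,x_k)\in I$ implies $f(g_1,\dots,g_k)\in I$ for all $g_1,\dots,g_k\in M_n(F)*F\langle X\rangle$. For $y\in M_n(F)*F\langle X\rangle$ put $\mathrm{tr}(y)=\sum_{i,j=1}^n e_{ij}\,y\,e_{ji}$, where the $e_{ij}$ are the standard matrix units of $M_n(F)$. Write each permutation $\sigma\in S_{n+1}$ as a product of disjoint cycles (including those of length one), the cycle of $n+1$ being written last and ending in $n+1$, $$\sigma=(i_1,\dots,i_{k_1})(j_1,\dots,j_{k_2})\cdots(u_1,\dots,u_{k_t})(s_1,\dots,s_k,n+1),$$ and let $$\phi_\sigma=\mathrm{tr}(x_{i_1}\cdots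 x_{i_{k_1}})\,\mathrm{tr}(x_{j_1}\cdots x_{j_{k_2}})\cdots\mathrm{tr}(x_{u_1}\cdots x_{u_{k_t}})\,x_{s_1}\cdots x_{s_k},\qquad Q_n=\sum_{\sigma\in S_{n+1}}\mathrm{sgn}(\sigma)\,\phi_\sigma .$$ As an element of $M_n(F)*F\langle X\rangle$, $Q_n$ may depend on the chosen order of the first cycles of each $\sigma$ and on the chosen first letters of these cycles; fix any such choice, independently for each $\sigma$. (On $M_n(F)$, $Q_n$ is, up to the sign $(-1)^n$, the full polarization of the Cayley-Hamilton polynomial.) Then the set of all GPIs of $M_n(F)$ is a T-ideal of $M_n(F)*F\langle X\rangle$, and it is generated, as a T-ideal, by $Q_n$; that is, it is the smallest T-ideal that contains $Q_n$. -/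

import Mathlib

universe u

namespace GPI

noncomputable section

/-- The two factors of the free product `M_n(F) * F⟨X⟩`, where `X = {x_0, x_1, x_2, …}`. -/
def Factor (n : ℕ) (F : Type u) [Field F] : Bool → Type u
  | false => Matrix (Fin n) (Fin n) F
  | true => FreeAlgebra F ℕ

instance instRingFactor (n : ℕ) (F : Type u) [Field F] : (b : Bool) → Ring (Factor n F b)
  | false => inferInstanceAs (Ring (Matrix (Fin n) (Fin n) F))
  | true => inferInstanceAs (Ring (FreeAlgebra F ℕ))

instance instAlgebraFactor (n : ℕ) (F : Type u) [Field F] :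
    (b : Bool) → Algebra F (Factor n F b)
  | false => inferInstanceAs (Algebra F (Matrix (Fin n) (Fin n) F))
  | true => inferInstanceAs (Algebra F (FreeAlgebra F ℕ))

/-- The algebra `M_n(F) * F⟨X⟩` of generalized polynomials: the free product (coproduct) of the
unital `F`-algebras `M_n(F)` and `F⟨X⟩`. -/
abbrev GenPoly (n : ℕ) (F : Type u) [Field F] : Type u :=
  LinearAlgebra.FreeProduct F (Factor n F)

/-- A matrix as a (constant) generalized polynomial. -/
def const (n : ℕ) (F : Type u) [Field F] : Matrix (Fin n) (Fin n) F →ₐ[F] GenPoly n F :=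
  LinearAlgebra.FreeProduct.ι F (Factor n F) false

/-- The canonical embedding of the free algebra. -/
def ofFree (n : ℕ) (F : Type u) [Field F] : FreeAlgebra F ℕ →ₐ[F] GenPoly n F :=
  LinearAlgebra.FreeProduct.ι F (Factor n F) true

/-- The indeterminates. -/
def x (n : ℕ) (F : Type u) [Field F] (k : ℕ) : GenPoly n F :=
  ofFree n F (FreeAlgebra.ι F k)

/-- The maps on the two factors given by `φ` on `M_n(F)` and by `x_k ↦ g k` on `F⟨X⟩`. -/
def factorMap {n : ℕ} {F : Type u} [Field F] {B : Type u} [Ring B] [Algebra F B]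
    (φ : Matrix (Fin n) (Fin n) F →ₐ[F] B) (g : ℕ → B) : (b : Bool) → Factor n F b →ₐ[F] B
  | false => φ
  | true => FreeAlgebra.lift F g

/-- The algebra homomorphism out of `M_n(F) * F⟨X⟩` which is `φ` on `M_n(F)` and maps `x_k` to
`g k`. -/
def aeval {n : ℕ} {F : Type u} [Field F] {B : Type u} [Ring B] [Algebra F B]
    (φ : Matrix (Fin n) (Fin n) F →ₐ[F] B) (g : ℕ → B) : GenPoly n F →ₐ[F] B :=
  LinearAlgebra.FreeProduct.lift F (Factor n F) (fun {b} => factorMap φ g b)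

/-- The evaluation `f ↦ f(b_0, b_1, …)` at matrices; it is the identity on `M_n(F)`. -/
def eval {n : ℕ} {F : Type u} [Field F] (b : ℕ → Matrix (Fin n) (Fin n) F) :
    GenPoly n F →ₐ[F] Matrix (Fin n) (Fin n) F :=
  aeval (AlgHom.id F _) b

/-- The substitution `f ↦ f(g_0, g_1, …)` of generalized polynomials for the indeterminates. -/
def subst {n : ℕ} {F : Type u} [Field F] (g : ℕ → GenPoly n F) :
    GenPoly n F →ₐ[F] GenPoly n F :=
  aeval (const n F) g

/-- Generalized polynomial identities of `M_n(F)`. -/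
def IsGPI {n : ℕ} {F : Type u} [Field F] (f : GenPoly n F) : Prop :=
  ∀ b : ℕ → Matrix (Fin n) (Fin n) F, eval b f = 0

/-- The ideal of all generalized polynomial identities of `M_n(F)`. -/
def gpiIdeal (n : ℕ) (F : Type u) [Field F] : TwoSidedIdeal (GenPoly n F) :=
  TwoSidedIdeal.mk' {f | IsGPI f}
    (fun b => map_zero (eval b))
    (fun {p q} hp hq b => by rw [map_add, hp b, hq b, add_zero])
    (fun {p} hp b => by rw [map_neg, hp b, neg_zero])
    (fun {p q} hq b => by rw [map_mul, hq b, mul_zero])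
    (fun {p q} hp b => by rw [map_mul, hp b, zero_mul])

theorem mem_gpiIdeal {n : ℕ} {F : Type u} [Field F] (f : GenPoly n F) :
    f ∈ gpiIdeal n F ↔ IsGPI f :=
  TwoSidedIdeal.mem_mk' _ _ _ _ _ _ f

/-- T-ideals: ideals which are closed under all substitutions. -/
def IsTIdeal {n : ℕ} {F : Type u} [Field F] (I : TwoSidedIdeal (GenPoly n F)) : Prop :=
  ∀ f ∈ I, ∀ g : ℕ → GenPoly n F, subst g f ∈ I

/-- The T-ideal generated by a set: the smallest T-ideal that contains it. -/
def tIdealSpan {n : ℕ} {F : Type u} [Field F] (S : Set (GenPoly n F)) :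
    TwoSidedIdeal (GenPoly n F) :=
  sInf {I | IsTIdeal I ∧ ∀ f ∈ S, f ∈ I}

/-- The trace `tr(y) = ∑_{i,j} e_{ij} y e_{ji}` in `M_n(F) * F⟨X⟩`. -/
def tr {n : ℕ} {F : Type u} [Field F] (y : GenPoly n F) : GenPoly n F :=
  ∑ i : Fin n, ∑ j : Fin n,
    const n F (Matrix.single i j 1) * y * const n F (Matrix.single j i 1)

/-- A way to write `σ`, a permutation of `{0, …, n}`, as a product of disjoint cycles (those of
length one included), with the cycle of the last letter `n` at the end, and with `n` at the end of
that cycle: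
`σ = (i_1, …, i_{k_1}) (j_1, …, j_{k_2}) ⋯ (u_1, …, u_{k_t}) (s_1, …, s_k, n)`.
The order of the other cycles and the first letter of each of them are free. -/
structure CycleNotation {n : ℕ} (σ : Equiv.Perm (Fin (n + 1))) where
  /-- the cycles that do not contain `n` -/
  cycles : List (List (Fin n))
  /-- the word `s_1, …, s_k` of the cycle that contains `n` -/
  last : List (Fin n)
  cycles_ne_nil : ∀ c ∈ cycles, c ≠ []
  nodup : (cycles.flatten ++ last).Nodup
  complete : ∀ i : Fin n, i ∈ cycles.flatten ++ last
  prod_eq : σ = (cycles.map fun c => (c.map Fin.castSucc).formPerm).prod *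
    (last.map Fin.castSucc ++ [Fin.last n]).formPerm

/-- Every permutation is a product of disjoint cycles. -/
theorem exists_cycles {α : Type*} [Fintype α] [DecidableEq α] (σ : Equiv.Perm α) :
    ∃ L : List (List α), (∀ c ∈ L, c ≠ []) ∧ L.flatten.Nodup ∧
      (∀ a ∈ L.flatten, a ∈ σ.support) ∧ (L.map List.formPerm).prod = σ := by
  induction σ using Equiv.Perm.cycle_induction_on with
  | base_one => exact ⟨[], by simp⟩
  | base_cycles σ hσ =>
    obtain ⟨a, ha, -⟩ := id hσ
    have ha' : a ∈ σ.support := by simpa using ha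
    refine ⟨[σ.toList a], ?_, ?_, ?_, ?_⟩
    · simp only [List.mem_singleton, forall_eq, ne_eq, Equiv.Perm.toList_eq_nil_iff]
      simpa using ha
    · simpa using Equiv.Perm.nodup_toList σ a
    · intro b hb
      have hb' : b ∈ σ.toList a := by simpa using hb
      exact (Equiv.Perm.mem_toList_iff.1 hb').1.mem_support_iff.1 ha'
    · simpa [Equiv.Perm.formPerm_toList] using hσ.cycleOf_eq ha
  | induction_disjoint σ τ hd hσ h1 h2 =>
    obtain ⟨L, hL1, hL2, hL3, hL4⟩ := h1
    obtain ⟨M, hM1, hM2, hM3, hM4⟩ := h2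
    refine ⟨L ++ M, ?_, ?_, ?_, ?_⟩
    · intro c hc
      rcases List.mem_append.1 hc with h | h
      exacts [hL1 c h, hM1 c h]
    · rw [List.flatten_append, List.nodup_append']
      refine ⟨hL2, hM2, fun a ha hb => ?_⟩
      exact Finset.disjoint_left.1 hd.disjoint_support (hL3 a ha) (hM3 a hb)
    · intro a ha
      rw [hd.support_mul, Finset.mem_union]
      rw [List.flatten_append] at ha
      exact (List.mem_append.1 ha).imp (hL3 a) (hM3 a)
    · rw [List.map_append, List.prod_append, hL4, hM4]

/-- Every permutation can be written in this way. -/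
instance instNonemptyCycleNotation {n : ℕ} (σ : Equiv.Perm (Fin (n + 1))) :
    Nonempty (CycleNotation σ) := by
  obtain ⟨L, hL1, hL2, hL3, hL4⟩ := exists_cycles σ
  -- add the fixed points
  obtain ⟨M, hM1, hM2, hM3, hM4⟩ : ∃ M : List (List (Fin (n + 1))), (∀ c ∈ M, c ≠ []) ∧
      M.flatten.Nodup ∧ (∀ a, a ∈ M.flatten) ∧ (M.map List.formPerm).prod = σ := by
    let fix : List (Fin (n + 1)) := (Finset.univ.filter fun a => a ∉ L.flatten).toList
    have hf : (fix.map fun a => [a]).flatten = fix := by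
      induction fix with
      | nil => rfl
      | cons a l ih => simp [ih]
    refine ⟨L ++ fix.map (fun a => [a]), ?_, ?_, ?_, ?_⟩
    · intro c hc
      rcases List.mem_append.1 hc with h | h
      · exact hL1 c h
      · obtain ⟨a, -, rfl⟩ := List.mem_map.1 h
        simp
    · rw [List.flatten_append, hf, List.nodup_append']
      refine ⟨hL2, Finset.nodup_toList _, fun a ha hb => ?_⟩
      have := Finset.mem_toList.1 hb
      exact (Finset.mem_filter.1 this).2 ha
    · intro a
      rw [List.flatten_append, hf, List.mem_append]
      by_cases h : a ∈ L.flatten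
      · exact Or.inl h
      · exact Or.inr (Finset.mem_toList.2 (Finset.mem_filter.2 ⟨Finset.mem_univ _, h⟩))
    · rw [List.map_append, List.prod_append, hL4, List.map_map]
      have : (fix.map (List.formPerm ∘ fun a => [a])).prod = 1 := by
        apply List.prod_eq_one
        intro p hp
        obtain ⟨a, -, rfl⟩ := List.mem_map.1 hp
        simp
      rw [this, mul_one]
  -- move the cycle of the last letter to the end
  obtain ⟨c, hc, hlast⟩ := List.mem_flatten.1 (hM3 (Fin.last n))
  obtain ⟨A, B, rfl⟩ := List.append_of_mem hc
  obtain ⟨s, t, rfl⟩ := List.append_of_mem hlast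
  have hperm : (A ++ (s ++ Fin.last n :: t) :: B).flatten.Perm
      (((A ++ B).flatten ++ (t ++ s)) ++ [Fin.last n]) := by
    rw [← Multiset.coe_eq_coe]
    simp only [List.flatten_append, List.flatten_cons, ← Multiset.coe_add,
      ← Multiset.cons_coe, ← Multiset.singleton_add, Multiset.coe_nil]
    abel
  have hN : (((A ++ B).flatten ++ (t ++ s)) ++ [Fin.last n]).Nodup := hperm.nodup_iff.1 hM2
  have hne : ∀ a ∈ (A ++ B).flatten ++ (t ++ s), a ≠ Fin.last n := by
    intro a ha h
    exact (List.nodup_append'.1 hN).2.2 ha (by simp [h])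
  have hlift : ∀ l : List (Fin (n + 1)), (∀ a ∈ l, a ≠ Fin.last n) →
      ∃ l' : List (Fin n), l'.map Fin.castSucc = l := by
    intro l
    induction l with
    | nil => exact fun _ => ⟨[], rfl⟩
    | cons a l ih =>
      intro h
      obtain ⟨l', rfl⟩ := ih fun b hb => h b (List.mem_cons_of_mem _ hb)
      exact ⟨a.castPred (h a List.mem_cons_self) :: l', by simp⟩
  have hlift2 : ∀ K : List (List (Fin (n + 1))), (∀ a ∈ K.flatten, a ≠ Fin.last n) →
      ∃ K' : List (List (Fin n)), K'.map (List.map Fin.castSucc) = K := by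
    intro K
    induction K with
    | nil => exact fun _ => ⟨[], rfl⟩
    | cons k K ih =>
      intro h
      obtain ⟨K', rfl⟩ := ih fun b hb => h b (by
        rw [List.flatten_cons]; exact List.mem_append_right _ hb)
      obtain ⟨k', rfl⟩ := hlift k fun b hb => h b (by
        rw [List.flatten_cons]; exact List.mem_append_left _ hb)
      exact ⟨k' :: K', rfl⟩
  obtain ⟨K, hK⟩ := hlift2 (A ++ B) fun a ha => hne a (List.mem_append_left _ ha)
  obtain ⟨l, hl⟩ := hlift (t ++ s) fun a ha => hne a (List.mem_append_right _ ha)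
  have hmap : (K.flatten ++ l).map Fin.castSucc = (A ++ B).flatten ++ (t ++ s) := by
    rw [List.map_append, List.map_flatten, hK, hl]
  refine ⟨⟨K, l, ?_, ?_, ?_, ?_⟩⟩
  · intro c hc h
    have : ([] : List (Fin (n + 1))) ∈ A ++ B := by
      rw [← hK]
      exact List.mem_map.2 ⟨c, hc, by rw [h]; rfl⟩
    refine hM1 [] ?_ rfl
    rcases List.mem_append.1 this with h | h
    · exact List.mem_append_left _ h
    · exact List.mem_append_right _ (List.mem_cons_of_mem _ h)
  · refine List.Nodup.of_map Fin.castSucc ?_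
    rw [hmap]
    exact (List.nodup_append'.1 hN).1
  · intro i
    have h1 : i.castSucc ∈ ((A ++ B).flatten ++ (t ++ s)) ++ [Fin.last n] :=
      hperm.mem_iff.1 (hM3 _)
    have h2 : i.castSucc ∈ (K.flatten ++ l).map Fin.castSucc := by
      rw [hmap]
      rcases List.mem_append.1 h1 with h | h
      · exact h
      · exact absurd (List.mem_singleton.1 h) (Fin.castSucc_lt_last i).ne
    obtain ⟨j, hj, hji⟩ := List.mem_map.1 h2
    rwa [← Fin.castSucc_injective n hji]
  · have e1 : (K.map fun c => (c.map Fin.castSucc).formPerm) = (A ++ B).map List.formPerm := by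
      rw [← hK, List.map_map]; rfl
    rw [hl, e1]
    have hcn : (s ++ Fin.last n :: t).Nodup := by
      rw [List.flatten_append, List.flatten_cons] at hM2
      exact (List.nodup_append'.1 (List.nodup_append'.1 hM2).2.1).1
    have e2 : (t ++ s ++ [Fin.last n]).formPerm = (s ++ Fin.last n :: t).formPerm := by
      refine (List.formPerm_eq_of_isRotated hcn ?_).symm
      have := List.isRotated_append (l := s ++ [Fin.last n]) (l' := t)
      simpa [List.append_assoc] using this
    rw [e2, ← hM4]
    simp only [List.map_append, List.map_cons, List.prod_append, List.prod_cons, mul_assoc]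
    congr 1
    refine (Equiv.Perm.Disjoint.commute ?_).eq
    refine Equiv.Perm.disjoint_prod_right _ fun g hg => ?_
    obtain ⟨b, hb, rfl⟩ := List.mem_map.1 hg
    intro a
    by_contra! h
    have ha1 := List.mem_of_formPerm_apply_ne h.1
    have ha2 := List.mem_of_formPerm_apply_ne h.2
    rw [List.flatten_append, List.flatten_cons] at hM2
    exact (List.nodup_append'.1 (List.nodup_append'.1 hM2).2.1).2.2 ha1
      (List.mem_flatten.2 ⟨b, hb, ha2⟩)

/-- The monomial `x_{i_1} ⋯ x_{i_k}` of a word. -/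
def word {n : ℕ} (F : Type u) [Field F] (c : List (Fin n)) : GenPoly n F :=
  (c.map fun i => x n F (i : ℕ)).prod

/-- `φ_σ = tr(x_{i_1} ⋯ x_{i_{k_1}}) ⋯ tr(x_{u_1} ⋯ x_{u_{k_t}}) x_{s_1} ⋯ x_{s_k}`. -/
def phi {n : ℕ} (F : Type u) [Field F] {σ : Equiv.Perm (Fin (n + 1))} (w : CycleNotation σ) :
    GenPoly n F :=
  (w.cycles.map fun c => tr (word F c)).prod * word F w.last

/-- The multilinear Cayley-Hamilton polynomial `Q_n = ∑_σ (-1)^σ φ_σ`, as an element of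
`M_n(F) * F⟨X⟩`. Traces do not commute with the indeterminates there (nor is the trace invariant
under cyclic rotations of words), so `Q_n` depends on how each permutation is written. -/
def cayleyHamilton {n : ℕ} (F : Type u) [Field F]
    (w : (σ : Equiv.Perm (Fin (n + 1))) → CycleNotation σ) : GenPoly n F :=
  ∑ σ : Equiv.Perm (Fin (n + 1)), ((Equiv.Perm.sign σ : ℤˣ) : ℤ) • phi F (w σ)

end

end GPI

/-!
The generalized polynomial identities of `M_n(F)` are those generalized polynomials which vanish at
generic matrices, because `F` is infinite (`genericEval_eq_zero`). The algebra `M_n(F) * F⟨X⟩`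
consists of the `n × n` matrices over the centralizer of `M_n(F)`, and this centralizer is the free
algebra in the entries of the `x_k`; passing to generic matrices amounts to letting these entries
commute. So everything reduces to two facts.

* `Q_n` is an identity (`isGPI_cayleyHamilton`). Since `φ_σ` is multilinear, `tr(Q_n y)` only has to
  be evaluated at matrix units `e_{p_k q_k}`. There `tr(φ_σ y)` is `∏_k [q_k = p_{σ(k)}]`, so the
  alternating sum over `σ` is the determinant of an `(n + 1) × (n + 1)` matrix `[q_k = p_l]`. By the
  pigeonhole principle two of the `p_l` agree, and the determinant has two equal columns
  (`sum_sign_traceProd`).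

* If `I` is a T-ideal that contains `Q_n`, then in the quotient by `I` the centralizer of `M_n(F)` is
  commutative (`commute_of_cayleyHamilton`). For elements `a`, `b` of the centralizer, evaluate
  `Q_n` at `a e_{01}`, `b e_{10}`, `e_{22}`, …, `e_{n-1,n-1}`. The value of `φ_σ` is its value at the
  matrix units times `a` and `b`, in the order in which the letters `0` and `1` are written.
  In the entry `(0, 0)` only `(0 1)` and `(0 1 n)` contribute, and the latter contributes `ab`;
  in the entry `(1, 1)` only `(0 1)` and `(1 0 n)` contribute, and the latter contributes `ba`.
  The transposition contributes the same in both, whatever choices were made in writing it, hence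
  `ab = ba`.

By the second fact the quotient map factors through generic matrices (`exists_comp_genericEval`), so
it kills all identities.
-/

namespace GPI

/-! ### Products of traces along the cycles of a permutation -/

section Combinatorics

variable {α : Type*} {n : ℕ} {F : Type u} [Field F]

/-- A product of matrix units `e_{p_k q_k}` along a word is nonzero only in the row of its first
factor, and only if every `q_k` equals the next `p_k`. -/
theorem prod_single_apply (p q : α → Fin n) (t : List α) (a : α) (r s : Fin n) :
    ((a :: t).map fun k => Matrix.single (p k) (q k) (1 : F)).prod r s =
      if r = p a then
        (List.zipWith (fun k u => if q k = u then (1 : F) else 0) (a :: t) (t.map p ++ [s])).prod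
      else 0 := by
  induction t generalizing a r with
  | nil =>
    simp [Matrix.single_apply, ite_and, eq_comm]
  | cons b t ih =>
    rw [List.map_cons, List.prod_cons]
    by_cases h : r = p a
    · rw [h, Matrix.single_mul_apply_same, ih]
      by_cases h' : q a = p b <;> simp [h']
    · rw [Matrix.single_mul_apply_of_ne _ _ _ _ _ h]
      simp [h]

variable [DecidableEq α]

/-- A product of disjoint cycles acts on the letters of one of them as this cycle alone. -/
theorem prod_map_formPerm_apply (L : List (List α)) (hL : L.flatten.Nodup) {c : List α}
    (hc : c ∈ L) {a : α} (ha : a ∈ c) : (L.map List.formPerm).prod a = c.formPerm a := by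
  induction L with
  | nil => simp at hc
  | cons d L ih =>
    rw [List.flatten_cons, List.nodup_append'] at hL
    obtain ⟨-, hL2, hdis⟩ := hL
    have fix : ∀ b, b ∉ L.flatten → (L.map List.formPerm).prod b = b := by
      intro b hb
      have : ∀ K : List (List α), b ∉ K.flatten → (K.map List.formPerm).prod b = b := by
        intro K
        induction K with
        | nil => simp
        | cons e K ihK =>
          intro h
          rw [List.flatten_cons, List.mem_append, not_or] at h
          rw [List.map_cons, List.prod_cons, Equiv.Perm.mul_apply, ihK h.2,
            List.formPerm_apply_of_notMem h.1]
      exact this L hb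
    rw [List.map_cons, List.prod_cons, Equiv.Perm.mul_apply]
    rcases List.mem_cons.1 hc with rfl | hc
    · rw [fix a (fun h => hdis ha h)]
    · rw [ih hL2 hc]
      refine List.formPerm_apply_of_notMem fun h => hdis h ?_
      exact List.mem_flatten.2 ⟨c, hc, List.formPerm_apply_mem_of_mem ha⟩

theorem map_formPerm_cons (a : α) (l : List α) (h : (a :: l).Nodup) :
    (a :: l).map (a :: l).formPerm = l ++ [a] := by
  have : l ++ [a] = (a :: l).rotate 1 := by simp
  rw [this]
  refine List.ext_getElem (by simp) fun i h1 h2 => ?_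
  rw [List.getElem_map, List.formPerm_apply_getElem _ h, List.getElem_rotate]

theorem trace_prod_single (p q : α → Fin n) (c : List α) (hc : c ≠ []) (hnd : c.Nodup) :
    (c.map fun k => Matrix.single (p k) (q k) (1 : F)).prod.trace =
      (c.map fun k => if q k = p (c.formPerm k) then (1 : F) else 0).prod := by
  obtain ⟨a, t, rfl⟩ := List.exists_cons_of_ne_nil hc
  have h1 : (List.zipWith (fun k u => if q k = u then (1 : F) else 0) (a :: t)
      (t.map p ++ [p a])) =
      (a :: t).map fun k => if q k = p ((a :: t).formPerm k) then (1 : F) else 0 := by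
    have : t.map p ++ [p a] = (a :: t).map fun k => p ((a :: t).formPerm k) := by
      rw [← Function.comp_def p, ← List.map_map, map_formPerm_cons a t hnd]
      simp
    rw [this, List.zipWith_map_right, List.zipWith_self]
  rw [Matrix.trace, ← h1]
  simp only [Matrix.diag_apply, prod_single_apply]
  rw [Finset.sum_ite, Finset.sum_const_zero, add_zero, Finset.filter_eq' Finset.univ (p a)]
  simp

/-- On matrix units the product of traces along the cycles of a permutation is a term of
the permutation expansion of a determinant. -/
theorem prod_trace_prod_single [Fintype α] (p q : α → Fin n) (L : List (List α))
    (hne : ∀ c ∈ L, c ≠ []) (hnd : L.flatten.Nodup) (hL : ∀ a, a ∈ L.flatten) :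
    (L.map fun c => (c.map fun k => Matrix.single (p k) (q k) (1 : F)).prod.trace).prod =
      ∏ k, if q k = p ((L.map List.formPerm).prod k) then (1 : F) else 0 := by
  have h1 : ∀ c ∈ L, (c.map fun k => Matrix.single (p k) (q k) (1 : F)).prod.trace =
      (c.map fun k => if q k = p ((L.map List.formPerm).prod k) then (1 : F) else 0).prod := by
    intro c hc
    rw [trace_prod_single p q c (hne c hc) ((List.nodup_flatten.1 hnd).1 c hc)]
    congr 1
    refine List.map_congr_left fun k hk => ?_
    rw [prod_map_formPerm_apply L hnd hc hk]
  rw [List.map_congr_left h1]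
  have h2 : (Finset.univ : Finset α) = L.flatten.toFinset := by
    ext a
    simpa using hL a
  rw [h2, List.prod_toFinset _ hnd, List.map_flatten, List.prod_flatten, List.map_map]
  rfl

end Combinatorics

/-! ### Multilinear functions of part of the variables -/

section Multilinear

variable {ι R M N N' : Type*} [DecidableEq ι] [CommRing R] [AddCommGroup M] [Module R M]

/-- `G` does not depend on the variables outside `S` and is linear in each of those in `S`. -/
structure MultilinearOn (R : Type*) [CommRing R] [Module R M] [AddCommGroup N] [Module R N]
    (S : Set ι) (G : (ι → M) → N) : Prop where
  update_of_notMem : ∀ b, ∀ i ∉ S, ∀ u, G (Function.update b i u) = G b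
  update_add : ∀ b, ∀ i ∈ S, ∀ u v, G (Function.update b i (u + v)) =
    G (Function.update b i u) + G (Function.update b i v)
  update_smul : ∀ b, ∀ i ∈ S, ∀ (r : R) u, G (Function.update b i (r • u)) =
    r • G (Function.update b i u)

namespace MultilinearOn

theorem proj (i : ι) : MultilinearOn R {i} fun b : ι → M => b i where
  update_of_notMem b j hj u := Function.update_of_ne (by simpa [eq_comm] using hj) _ _
  update_add b j hj u v := by
    rw [Set.mem_singleton_iff] at hj; subst hj; simp
  update_smul b j hj r u := by
    rw [Set.mem_singleton_iff] at hj; subst hj; simp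

theorem map [AddCommGroup N] [Module R N] [AddCommGroup N'] [Module R N'] {S : Set ι}
    {G : (ι → M) → N} (hG : MultilinearOn R S G) (f : N →ₗ[R] N') :
    MultilinearOn R S fun b => f (G b) where
  update_of_notMem b j hj u := by rw [hG.update_of_notMem b j hj]
  update_add b j hj u v := by rw [hG.update_add b j hj, map_add]
  update_smul b j hj r u := by rw [hG.update_smul b j hj, map_smul]

variable [Ring N] [Algebra R N]

theorem one : MultilinearOn R (∅ : Set ι) fun _ : ι → M => (1 : N) where
  update_of_notMem _ _ _ _ := rfl
  update_add _ _ h := h.elim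
  update_smul _ _ h := h.elim

theorem mul {S T : Set ι} {G H : (ι → M) → N} (hG : MultilinearOn R S G)
    (hH : MultilinearOn R T H) (hST : Disjoint S T) :
    MultilinearOn R (S ∪ T) fun b => G b * H b where
  update_of_notMem b j hj u := by
    rw [Set.mem_union, not_or] at hj
    rw [hG.update_of_notMem b j hj.1, hH.update_of_notMem b j hj.2]
  update_add b j hj u v := by
    rcases hj with hj | hj
    · have := Set.disjoint_left.1 hST hj
      simp only [hG.update_add b j hj, hH.update_of_notMem b j this, add_mul]
    · have := Set.disjoint_right.1 hST hj
      simp only [hH.update_add b j hj, hG.update_of_notMem b j this, mul_add]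
  update_smul b j hj r u := by
    rcases hj with hj | hj
    · have := Set.disjoint_left.1 hST hj
      simp only [hG.update_smul b j hj, hH.update_of_notMem b j this, smul_mul_assoc]
    · have := Set.disjoint_right.1 hST hj
      simp only [hH.update_smul b j hj, hG.update_of_notMem b j this, mul_smul_comm]

theorem list_prod {κ : Type*} (S : κ → Set ι) (G : κ → (ι → M) → N)
    (hG : ∀ k, MultilinearOn R (S k) (G k)) (l : List κ)
    (hl : l.Pairwise fun k k' => Disjoint (S k) (S k')) :
    MultilinearOn R {i | ∃ k ∈ l, i ∈ S k} fun b => (l.map fun k => G k b).prod := by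
  induction l with
  | nil => simpa using one
  | cons k l ih =>
    rw [List.pairwise_cons] at hl
    have := (hG k).mul (ih hl.2) (by
      rw [Set.disjoint_left]
      rintro i hi ⟨k', hk', hi'⟩
      exact Set.disjoint_left.1 (hl.1 k' hk') hi hi')
    convert this using 1
    · ext i; simp
    · simp

end MultilinearOn

end Multilinear

/-! ### The fundamental trace identity -/

section TraceIdentity

variable {n : ℕ} {F : Type u} [Field F]

/-- All cycles of `σ`, with the one that contains the last letter at the end. -/
def CycleNotation.allCycles {σ : Equiv.Perm (Fin (n + 1))} (w : CycleNotation σ) :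
    List (List (Fin (n + 1))) :=
  w.cycles.map (List.map Fin.castSucc) ++ [w.last.map Fin.castSucc ++ [Fin.last n]]

namespace CycleNotation

variable {σ : Equiv.Perm (Fin (n + 1))} (w : CycleNotation σ)

theorem flatten_allCycles :
    w.allCycles.flatten = (w.cycles.flatten ++ w.last).map Fin.castSucc ++ [Fin.last n] := by
  simp [allCycles, List.map_flatten]

theorem allCycles_ne_nil (c : List (Fin (n + 1))) (hc : c ∈ w.allCycles) : c ≠ [] := by
  rcases List.mem_append.1 hc with h | h
  · obtain ⟨d, hd, rfl⟩ := List.mem_map.1 h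
    simpa using w.cycles_ne_nil d hd
  · simp [List.mem_singleton.1 h]

theorem nodup_flatten_allCycles : w.allCycles.flatten.Nodup := by
  rw [flatten_allCycles, List.nodup_append']
  refine ⟨w.nodup.map (Fin.castSucc_injective n), by simp, fun a ha hb => ?_⟩
  obtain ⟨i, -, rfl⟩ := List.mem_map.1 ha
  exact (Fin.castSucc_lt_last i).ne (List.mem_singleton.1 hb)

theorem mem_flatten_allCycles (a : Fin (n + 1)) : a ∈ w.allCycles.flatten := by
  rw [flatten_allCycles]
  induction a using Fin.lastCases with
  | last => simp
  | cast i => exact List.mem_append_left _ (List.mem_map_of_mem (w.complete i))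

theorem prod_formPerm_allCycles : (w.allCycles.map List.formPerm).prod = σ := by
  refine Eq.trans ?_ w.prod_eq.symm
  simp [allCycles, Function.comp_def]

/-- The invariant `∏ tr(b_{i_1} ⋯ b_{i_k})` of matrices, the product taken over all cycles
`(i_1, …, i_k)` of a permutation. -/
def traceProd (b : Fin (n + 1) → Matrix (Fin n) (Fin n) F) : F :=
  (w.allCycles.map fun c => (c.map b).prod.trace).prod

theorem traceProd_single (p q : Fin (n + 1) → Fin n) :
    w.traceProd (fun k => Matrix.single (p k) (q k) (1 : F)) =
      ∏ k, if q k = p (σ k) then (1 : F) else 0 := by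
  rw [traceProd, prod_trace_prod_single p q _ w.allCycles_ne_nil w.nodup_flatten_allCycles
    w.mem_flatten_allCycles, w.prod_formPerm_allCycles]

theorem multilinearOn_traceProd :
    MultilinearOn F Set.univ
      (w.traceProd : (Fin (n + 1) → Matrix (Fin n) (Fin n) F) → F) := by
  obtain ⟨hnd, hdis⟩ := List.nodup_flatten.1 w.nodup_flatten_allCycles
  -- words with repeated letters are replaced by `1`, so that every factor is multilinear
  let G : List (Fin (n + 1)) → (Fin (n + 1) → Matrix (Fin n) (Fin n) F) → F := fun c b =>
    if c.Nodup then (c.map b).prod.trace else 1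
  let S : List (Fin (n + 1)) → Set (Fin (n + 1)) := fun c => if c.Nodup then {i | i ∈ c} else ∅
  have hG : ∀ c, MultilinearOn F (S c) (G c) := by
    intro c
    by_cases hc : c.Nodup
    · have := (MultilinearOn.list_prod (R := F) (M := Matrix (Fin n) (Fin n) F) (fun i => {i})
        (fun i b => b i) MultilinearOn.proj c
        (hc.imp fun h => by simpa [eq_comm] using h)).map (Matrix.traceLinearMap (Fin n) F F)
      simpa [G, S, hc] using this
    · simpa [G, S, hc] using MultilinearOn.one
  have key := MultilinearOn.list_prod S G hG w.allCycles (by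
    refine hdis.imp fun {c d} h => ?_
    simp only [S]
    split_ifs
    · exact Set.disjoint_left.2 fun a ha hb => h ha hb
    all_goals simp)
  have hS : {i | ∃ c ∈ w.allCycles, i ∈ S c} = Set.univ := by
    refine Set.eq_univ_of_forall fun i => ?_
    obtain ⟨c, hc, hi⟩ := List.mem_flatten.1 (w.mem_flatten_allCycles i)
    exact ⟨c, hc, by simpa [S, hnd c hc] using hi⟩
  have hF : (fun b => (w.allCycles.map fun c => G c b).prod) = w.traceProd := by
    funext b
    exact congrArg List.prod (List.map_congr_left fun c hc => by simp [G, hnd c hc])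
  rwa [hS, hF] at key

end CycleNotation

/-- The fundamental trace identity of `n × n` matrices. On matrix units `e_{p_k q_k}` the sum is
the determinant of the matrix with entries `[q_k = p_l]`; two of its `n + 1` columns are equal. -/
theorem sum_sign_traceProd (w : (σ : Equiv.Perm (Fin (n + 1))) → CycleNotation σ)
    (b : Fin (n + 1) → Matrix (Fin n) (Fin n) F) :
    ∑ σ, ((Equiv.Perm.sign σ : ℤˣ) : ℤ) • (w σ).traceProd b = 0 := by
  let E (σ : Equiv.Perm (Fin (n + 1))) :
      MultilinearMap F (fun _ : Fin (n + 1) => Matrix (Fin n) (Fin n) F) F :=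
    MultilinearMap.mk' (w σ).traceProd
      (fun b i u v => (w σ).multilinearOn_traceProd.update_add b i (Set.mem_univ i) u v)
      (fun b i r u => (w σ).multilinearOn_traceProd.update_smul b i (Set.mem_univ i) r u)
  have hE : ∑ σ, ((Equiv.Perm.sign σ : ℤˣ) : ℤ) • E σ = 0 := by
    refine Module.Basis.ext_multilinear
      (fun _ => Matrix.stdBasis F (Fin n) (Fin n)) fun v => ?_
    have hv : (fun i => (Matrix.stdBasis F (Fin n) (Fin n)) (v i)) =
        fun i => Matrix.single (v i).1 (v i).2 (1 : F) := by
      funext i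
      exact Matrix.stdBasis_eq_single F (v i).1 (v i).2
    rw [hv, sum_apply, zero_apply]
    obtain ⟨i, j, hij, hp⟩ := Fintype.exists_ne_map_eq_of_card_lt (fun k => (v k).1)
      (by simp : Fintype.card (Fin n) < Fintype.card (Fin (n + 1)))
    have hdet : (Matrix.of fun k l => if (v k).2 = (v l).1 then (1 : F) else 0).det = 0 :=
      Matrix.det_zero_of_column_eq hij fun k => by simp only [Matrix.of_apply]; rw [hp]
    rw [← Matrix.det_transpose, Matrix.det_apply] at hdet
    rw [← hdet]
    refine Finset.sum_congr rfl fun σ _ => ?_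
    rw [smul_apply]
    have : E σ (fun i => Matrix.single (v i).1 (v i).2 (1 : F)) = _ :=
      (w σ).traceProd_single (fun k => (v k).1) (fun k => (v k).2)
    rw [this]
    simp [Units.smul_def]
  have := congrArg (fun f => f b) hE
  simpa [E, sum_apply, smul_apply] using this

end TraceIdentity

/-! ### Homomorphisms out of the algebra of generalized polynomials -/

section Aeval

variable {n : ℕ} {F : Type u} [Field F] {B : Type u} [Ring B] [Algebra F B]

theorem aeval_const (ψ : Matrix (Fin n) (Fin n) F →ₐ[F] B) (g : ℕ → B)
    (M : Matrix (Fin n) (Fin n) F) : aeval ψ g (const n F M) = ψ M :=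
  DFunLike.congr_fun (LinearAlgebra.FreeProduct.lift_comp_ι F (Factor n F)
    (fun {b} => factorMap ψ g b) (i := false)) M

theorem aeval_x (ψ : Matrix (Fin n) (Fin n) F →ₐ[F] B) (g : ℕ → B) (k : ℕ) :
    aeval ψ g (x n F k) = g k :=
  (DFunLike.congr_fun (LinearAlgebra.FreeProduct.lift_comp_ι F (Factor n F)
    (fun {b} => factorMap ψ g b) (i := true)) (FreeAlgebra.ι F k)).trans
    (FreeAlgebra.lift_ι_apply g k)

theorem algHom_ext {f g : GenPoly n F →ₐ[F] B} (hc : ∀ M, f (const n F M) = g (const n F M))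
    (hx : ∀ k, f (x n F k) = g (x n F k)) : f = g := by
  apply (LinearAlgebra.FreeProduct.lift F (Factor n F)).symm.injective
  funext b
  cases b with
  | false => exact AlgHom.ext hc
  | true =>
    have : f.comp (ofFree n F) = g.comp (ofFree n F) := FreeAlgebra.hom_ext (funext hx)
    exact this

/-- A substitution followed by a homomorphism is an evaluation. -/
theorem map_subst (f : GenPoly n F →ₐ[F] B) (g : ℕ → GenPoly n F) (p : GenPoly n F) :
    f (subst g p) = aeval (f.comp (const n F)) (fun k => f (g k)) p := by
  refine DFunLike.congr_fun (f := f.comp (subst g)) (algHom_ext (fun M => ?_) fun k => ?_) p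
  · simp [subst, aeval_const]
  · simp [subst, aeval_x]

theorem isTIdeal_gpiIdeal : IsTIdeal (gpiIdeal n F) := by
  intro f hf g
  rw [mem_gpiIdeal] at hf ⊢
  intro b
  rw [map_subst]
  have : (eval b).comp (const n F) = AlgHom.id F _ := AlgHom.ext fun M => aeval_const _ _ M
  rw [this]
  exact hf _

end Aeval

/-! ### Values of the Cayley-Hamilton polynomial -/

section Values

variable {n : ℕ} {F : Type u} [Field F]

theorem sum_single_mul_mul_single (M : Matrix (Fin n) (Fin n) F) :
    ∑ i, ∑ j, Matrix.single i j 1 * M * Matrix.single j i 1 =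
      algebraMap F (Matrix (Fin n) (Fin n) F) M.trace := by
  simp only [Matrix.single_mul_mul_single, one_mul, mul_one]
  rw [Matrix.algebraMap_eq_diagonal, ← Matrix.sum_single_eq_diagonal]
  refine Finset.sum_congr rfl fun i _ => ?_
  exact (map_sum (Matrix.singleAddMonoidHom (α := F) i i) (fun j => M j j) Finset.univ).symm

variable {B : Type u} [Ring B] [Algebra F B]

/-- The trace `∑ e_{ij} y e_{ji}` in an algebra `B` with a homomorphism `ψ : M_n(F) → B`. -/
def trace (ψ : Matrix (Fin n) (Fin n) F →ₐ[F] B) : B →ₗ[F] B :=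
  ∑ i, ∑ j, (LinearMap.mulRight F (ψ (Matrix.single j i 1))).comp
    (LinearMap.mulLeft F (ψ (Matrix.single i j 1)))

theorem trace_apply (ψ : Matrix (Fin n) (Fin n) F →ₐ[F] B) (y : B) :
    trace ψ y = ∑ i, ∑ j, ψ (Matrix.single i j 1) * y * ψ (Matrix.single j i 1) := by
  simp [trace, LinearMap.sum_apply]

theorem trace_mul_map (ψ : Matrix (Fin n) (Fin n) F →ₐ[F] B) {d : B}
    (hd : ∀ M, Commute d (ψ M)) (M : Matrix (Fin n) (Fin n) F) :
    trace ψ (d * ψ M) = d * algebraMap F B M.trace := by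
  rw [trace_apply, ← ψ.commutes, ← sum_single_mul_mul_single, map_sum, Finset.mul_sum]
  refine Finset.sum_congr rfl fun i _ => ?_
  rw [map_sum, Finset.mul_sum]
  refine Finset.sum_congr rfl fun j _ => ?_
  rw [map_mul, map_mul, ← mul_assoc, ← mul_assoc, ← mul_assoc, (hd _).eq]

/-- The value of `φ_σ` at elements of an algebra `B` with a homomorphism `ψ : M_n(F) → B`. -/
def phiValue (ψ : Matrix (Fin n) (Fin n) F →ₐ[F] B) (r : Fin n → B)
    {σ : Equiv.Perm (Fin (n + 1))} (w : CycleNotation σ) : B :=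
  (w.cycles.map fun c => trace ψ (c.map r).prod).prod * (w.last.map r).prod

theorem aeval_cayleyHamilton (ψ : Matrix (Fin n) (Fin n) F →ₐ[F] B) (g : ℕ → B)
    (w : (σ : Equiv.Perm (Fin (n + 1))) → CycleNotation σ) :
    aeval ψ g (cayleyHamilton F w) =
      ∑ σ, ((Equiv.Perm.sign σ : ℤˣ) : ℤ) • phiValue ψ (fun i => g i) (w σ) := by
  have hword : ∀ c : List (Fin n), aeval ψ g (word F c) = (c.map fun i : Fin n => g i).prod := by
    intro c
    rw [word, map_list_prod, List.map_map]
    simp [Function.comp_def, aeval_x, ← List.map_eq_flatMap]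
  have htr : ∀ y : GenPoly n F, aeval ψ g (tr y) = trace ψ (aeval ψ g y) := by
    intro y
    simp [tr, trace_apply, aeval_const]
  rw [cayleyHamilton, map_sum]
  refine Finset.sum_congr rfl fun σ _ => ?_
  rw [map_zsmul, phi, map_mul, hword, map_list_prod, List.map_map]
  simp [phiValue, Function.comp_def, htr, hword]

theorem commute_prod_map {ψ : Matrix (Fin n) (Fin n) F →ₐ[F] B} {d : Fin n → B}
    (hd : ∀ i M, Commute (d i) (ψ M)) (c : List (Fin n)) (M : Matrix (Fin n) (Fin n) F) :
    Commute (c.map d).prod (ψ M) := by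
  refine Commute.list_prod_left _ _ fun y hy => ?_
  obtain ⟨i, -, rfl⟩ := List.mem_map.1 hy
  exact hd i M

theorem CycleNotation.traceProd_snoc {σ : Equiv.Perm (Fin (n + 1))} (w : CycleNotation σ)
    (m : Fin n → Matrix (Fin n) (Fin n) F) (y : Matrix (Fin n) (Fin n) F) :
    w.traceProd (Fin.snoc (α := fun _ => Matrix (Fin n) (Fin n) F) m y) =
      (w.cycles.map fun c => (c.map m).prod.trace).prod * ((w.last.map m).prod * y).trace := by
  simp [CycleNotation.traceProd, CycleNotation.allCycles, Function.comp_def]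

/-- Scalars which commute with `ψ(M_n(F))` can be taken out of `φ_σ`; they are multiplied in the
order in which the letters are written. -/
theorem phiValue_mul (ψ : Matrix (Fin n) (Fin n) F →ₐ[F] B) (d : Fin n → B)
    (hd : ∀ i M, Commute (d i) (ψ M)) (m : Fin n → Matrix (Fin n) (Fin n) F)
    {σ : Equiv.Perm (Fin (n + 1))} (w : CycleNotation σ) :
    phiValue ψ (fun i => d i * ψ (m i)) w =
      ((w.cycles.flatten ++ w.last).map d).prod *
        ψ ((w.cycles.map fun c => (c.map m).prod.trace).prod • (w.last.map m).prod) := by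
  have hword : ∀ c : List (Fin n), (c.map fun i => d i * ψ (m i)).prod =
      (c.map d).prod * ψ (c.map m).prod := by
    intro c
    induction c with
    | nil => simp
    | cons i c ih =>
      simp only [List.map_cons, List.prod_cons, map_mul, ih]
      rw [mul_assoc, ← mul_assoc (ψ (m i)), ← (commute_prod_map hd c (m i)).eq]
      simp only [mul_assoc]
  have hcycles : ∀ L : List (List (Fin n)),
      (L.map fun c => trace ψ (c.map fun i => d i * ψ (m i)).prod).prod =
        (L.flatten.map d).prod * algebraMap F B (L.map fun c => (c.map m).prod.trace).prod := by
    intro L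
    induction L with
    | nil => simp
    | cons c L ih =>
      simp only [List.map_cons, List.prod_cons, List.flatten_cons, List.map_append,
        List.prod_append, map_mul]
      rw [ih, hword, trace_mul_map ψ (commute_prod_map hd c)]
      rw [mul_assoc, ← mul_assoc (algebraMap F B _), Algebra.commutes (c.map m).prod.trace]
      simp only [mul_assoc]
  rw [phiValue, hcycles, hword, List.map_append, List.prod_append, map_smul, Algebra.smul_def,
    mul_assoc, ← mul_assoc (algebraMap F B _), Algebra.commutes, mul_assoc, mul_assoc]

/-- Multiplying `φ_σ` by one more matrix and taking the trace closes the last cycle of `σ`. -/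
theorem trace_phiValue_mul (ψ : Matrix (Fin n) (Fin n) F →ₐ[F] B) (d : Fin n → B)
    (hd : ∀ i M, Commute (d i) (ψ M)) (m : Fin n → Matrix (Fin n) (Fin n) F)
    (y : Matrix (Fin n) (Fin n) F) {σ : Equiv.Perm (Fin (n + 1))} (w : CycleNotation σ) :
    trace ψ (phiValue ψ (fun i => d i * ψ (m i)) w * ψ y) =
      ((w.cycles.flatten ++ w.last).map d).prod *
        algebraMap F B (w.traceProd (Fin.snoc (α := fun _ => Matrix (Fin n) (Fin n) F) m y)) := by
  rw [phiValue_mul ψ d hd, mul_assoc, ← map_mul, trace_mul_map ψ (commute_prod_map hd _)]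
  rw [w.traceProd_snoc, smul_mul_assoc, Matrix.trace_smul, smul_eq_mul]

/-- The trace form is nondegenerate, so it suffices that `tr(Q_n(b) y) = 0` for all `y`, which is
the fundamental trace identity for `b_0, …, b_{n-1}, y`. -/
theorem isGPI_cayleyHamilton (w : (σ : Equiv.Perm (Fin (n + 1))) → CycleNotation σ) :
    IsGPI (cayleyHamilton F w) := by
  intro b
  refine (Matrix.ext_iff_trace_mul_right).2 fun y => ?_
  have hphi : ∀ σ, phiValue (AlgHom.id F _) (fun i => b i) (w σ) =
      ((w σ).cycles.map fun c => (c.map fun i : Fin n => b i).prod.trace).prod •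
        ((w σ).last.map fun i : Fin n => b i).prod := by
    intro σ
    simpa [Function.comp_def] using phiValue_mul (AlgHom.id F (Matrix (Fin n) (Fin n) F)) (fun _ => 1)
      (fun _ _ => Commute.one_left _) (fun i => b i) (w σ)
  rw [eval, aeval_cayleyHamilton, zero_mul, Matrix.trace_zero, Finset.sum_mul, Matrix.trace_sum,
    ← sum_sign_traceProd w (Fin.snoc (α := fun _ => Matrix (Fin n) (Fin n) F) (fun i => b i) y)]
  refine Finset.sum_congr rfl fun σ _ => ?_
  rw [hphi, (w σ).traceProd_snoc, smul_mul_assoc, Matrix.trace_smul, smul_mul_assoc,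
    Matrix.trace_smul, smul_eq_mul]

end Values
/-! ### Commutativity of the centralizer of the matrix units -/

section Centralizer

/-- If `σ` maps `n ↦ i ↦ j`, then the letter `i` is written before `j` in every notation of `σ`,
because the cycle of `n` comes last and ends in `n`. -/
theorem CycleNotation.prod_map_of_threeCycle {n : ℕ} {B : Type*} [Monoid B] {i j : Fin n}
    (hij : i ≠ j) {σ : Equiv.Perm (Fin (n + 1))} (w : CycleNotation σ)
    (h1 : σ (Fin.last n) = i.castSucc) (h2 : σ i.castSucc = j.castSucc) (d : Fin n → B)
    (hd : ∀ k, k ≠ i → k ≠ j → d k = 1) :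
    ((w.cycles.flatten ++ w.last).map d).prod = d i * d j := by
  -- `C` is the cycle of the last letter: `n` goes to its first letter, which is therefore `i`
  set C : List (Fin (n + 1)) := w.last.map Fin.castSucc ++ [Fin.last n] with hCdef
  have hC : C ∈ w.allCycles := by simp [allCycles, hCdef]
  have key : ∀ a ∈ C, σ a = C.formPerm a := by
    intro a ha
    have := prod_map_formPerm_apply w.allCycles w.nodup_flatten_allCycles hC ha
    rwa [w.prod_formPerm_allCycles] at this
  obtain ⟨t, ht⟩ : ∃ t, w.last = i :: t := by
    have h := key (Fin.last n) (by simp [hCdef])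
    rw [h1] at h
    rcases hl : w.last with _ | ⟨k, t⟩
    · rw [hCdef, hl] at h
      simp at h
    · refine ⟨t, ?_⟩
      have hg := List.formPerm_apply_getLast k.castSucc (t.map Fin.castSucc ++ [Fin.last n])
      rw [hCdef, hl] at h
      simp only [← List.cons_append, List.getLast_append_singleton] at hg
      rw [List.map_cons, hg] at h
      rw [Fin.castSucc_injective n h]
  -- the other cycles contain neither `i` nor `j`
  have hjt : j ∈ t := by
    have hi : i.castSucc ∈ C := by simp [hCdef, ht]
    have : j.castSucc ∈ C := by
      rw [← h2, key _ hi]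
      exact List.formPerm_apply_mem_of_mem hi
    simpa [hCdef, ht, hij.symm] using this
  have hnd := w.nodup
  rw [ht, List.nodup_append', List.nodup_cons] at hnd
  obtain ⟨-, ⟨hit, hndt⟩, hdis⟩ := hnd
  have hone : ∀ l : List (Fin n), i ∉ l → j ∉ l → (l.map d).prod = 1 := by
    intro l hi hj
    refine List.prod_eq_one fun y hy => ?_
    obtain ⟨k, hk, rfl⟩ := List.mem_map.1 hy
    exact hd k (fun h => hi (h ▸ hk)) (fun h => hj (h ▸ hk))
  obtain ⟨u, v, rfl⟩ := List.append_of_mem hjt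
  have hju : j ∉ u ∧ j ∉ v := by
    rw [List.nodup_append', List.nodup_cons] at hndt
    exact ⟨fun h => hndt.2.2 h List.mem_cons_self, hndt.2.1.1⟩
  simp only [List.mem_append, List.mem_cons, not_or] at hit
  rw [ht, List.map_append, List.prod_append,
    hone _ (fun h => hdis h (by simp)) (fun h => hdis h (by simp)), one_mul]
  simp [hone u hit.1 hju.1, hone v hit.2.2 hju.2]

variable {n : ℕ} {F : Type u} [Field F] {B : Type u} [Ring B] [Algebra F B]

/-- For `x_k = d_k e_{k s(k)}`, where `s = (i j)`, only two permutations contribute to the `(i, i)`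
entry of the Cayley-Hamilton polynomial: `(i j)` and `(i j n)`. -/
theorem prod_map_eq_of_cayleyHamilton (ψ : Matrix (Fin n) (Fin n) F →ₐ[F] B)
    (w : (σ : Equiv.Perm (Fin (n + 1))) → CycleNotation σ)
    (hQ : ∀ r : Fin n → B,
      ∑ σ, ((Equiv.Perm.sign σ : ℤˣ) : ℤ) • phiValue ψ r (w σ) = 0)
    {i j : Fin n} (hij : i ≠ j) (d : Fin n → B) (hd : ∀ k M, Commute (d k) (ψ M))
    {s c : Equiv.Perm (Fin (n + 1))} (hs : s = Equiv.swap i.castSucc j.castSucc)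
    (hc : c = Equiv.swap i.castSucc (Fin.last n) * s) :
    (((w c).cycles.flatten ++ (w c).last).map d).prod =
      (((w s).cycles.flatten ++ (w s).last).map d).prod := by
  have hi : i.castSucc ≠ Fin.last n := (Fin.castSucc_lt_last i).ne
  have hj : j.castSucc ≠ Fin.last n := (Fin.castSucc_lt_last j).ne
  have hij' : i.castSucc ≠ j.castSucc := fun h => hij (Fin.castSucc_injective n h)
  -- the rows `p k` and columns `q k` of the matrix units; the last one, `e_{ii}`, extracts the entry
  let p : Fin (n + 1) → Fin n := Fin.snoc (α := fun _ => Fin n) id i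
  let q : Fin (n + 1) → Fin n := fun k => p (s k)
  have hp : ∀ a b, p a = p b → a ≠ b → (a = i.castSucc ∧ b = Fin.last n) ∨
      (a = Fin.last n ∧ b = i.castSucc) := by
    intro a b
    induction a using Fin.lastCases <;> induction b using Fin.lastCases <;>
      simp +contextual [p, eq_comm]
  have hpswap : ∀ a, p (Equiv.swap i.castSucc (Fin.last n) a) = p a := by
    intro a
    rw [Equiv.swap_apply_def]
    split_ifs with h1 h2
    · simp [p, h1]
    · simp [p, h2]
    · rfl
  -- `p` identifies only `i` and the last letter, so `p ∘ σ = p ∘ s` determines `σ` up to their swap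
  have hpq : ∀ σ : Equiv.Perm (Fin (n + 1)), (∀ k, q k = p (σ k)) ↔ σ = s ∨ σ = c := by
    intro σ
    constructor
    · intro h
      have hτ : ∀ a, p ((σ * s⁻¹) a) = p a := fun a => by
        rw [Equiv.Perm.mul_apply, ← h]
        simp [q]
      by_cases h1 : (σ * s⁻¹) i.castSucc = i.castSucc
      · left
        rw [← mul_inv_eq_one]
        ext1 a
        by_contra hne
        rcases hp _ _ (hτ a) hne with ⟨ha, rfl⟩ | ⟨-, rfl⟩
        · exact hi ((σ * s⁻¹).injective (h1.trans ha.symm))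
        · exact hne h1
      · right
        rw [hc, ← mul_inv_eq_iff_eq_mul]
        have h2 : (σ * s⁻¹) i.castSucc = Fin.last n := by
          rcases hp _ _ (hτ _) h1 with ⟨-, h⟩ | ⟨h, -⟩
          · exact absurd h hi
          · exact h
        have h3 : (σ * s⁻¹) (Fin.last n) = i.castSucc := by
          have hne : (σ * s⁻¹) (Fin.last n) ≠ Fin.last n := fun h =>
            hi ((σ * s⁻¹).injective (h2.trans h.symm))
          rcases hp _ _ (hτ _) hne with ⟨h, -⟩ | ⟨-, h⟩
          · exact h
          · exact absurd h.symm hi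
        ext1 a
        rw [Equiv.swap_apply_def]
        split_ifs with ha hb
        · rw [ha, h2]
        · rw [hb, h3]
        · by_contra hne
          rcases hp _ _ (hτ a) hne with ⟨-, h⟩ | ⟨-, h⟩
          · exact hb h
          · exact ha h
    · rintro (rfl | rfl) k
      · rfl
      · simp only [q, hc, Equiv.Perm.mul_apply, hpswap]
  let m : Fin n → Matrix (Fin n) (Fin n) F := fun k =>
    Matrix.single (p k.castSucc) (q k.castSucc) 1
  have hsnoc : Fin.snoc (α := fun _ => Matrix (Fin n) (Fin n) F) m (Matrix.single i i 1) =
      fun k => Matrix.single (p k) (q k) (1 : F) := by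
    funext k
    induction k using Fin.lastCases with
    | last =>
      have : s (Fin.last n) = Fin.last n := by
        rw [hs, Equiv.swap_apply_of_ne_of_ne hi.symm hj.symm]
      simp [q, p, this]
    | cast k => simp [m]
  -- multiply by `e_{ii}` and take the trace
  have h0 := congrArg (fun z => trace ψ (z * ψ (Matrix.single i i 1)))
    (hQ fun k => d k * ψ (m k))
  simp only [Finset.sum_mul, map_sum, zero_mul, map_zero, smul_mul_assoc, map_zsmul,
    trace_phiValue_mul ψ d hd, hsnoc, CycleNotation.traceProd_single] at h0
  have hsc : s ≠ c := by
    rw [hc]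
    intro h
    have := (mul_eq_right.1 h.symm)
    exact hi (Equiv.swap_eq_one_iff.1 this)
  have hprod : ∀ σ : Equiv.Perm (Fin (n + 1)),
      (∏ k, if q k = p (σ k) then (1 : F) else 0) = if σ = s ∨ σ = c then 1 else 0 := by
    intro σ
    rw [Finset.prod_ite_zero]
    simp only [Finset.mem_univ, forall_true_left, hpq, Finset.prod_const_one]
  simp only [hprod] at h0
  rw [Fintype.sum_eq_add s c hsc] at h0
  · have hsign : Equiv.Perm.sign s = -1 := by rw [hs, Equiv.Perm.sign_swap hij']
    have hsignc : Equiv.Perm.sign c = 1 := by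
      rw [hc, map_mul, hsign, Equiv.Perm.sign_swap hi]; simp
    rw [hsign, hsignc] at h0
    simp only [true_or, or_true, if_true, map_one, mul_one, Units.val_neg, Units.val_one,
      neg_smul, one_smul] at h0
    exact (neg_add_eq_zero.1 h0).symm
  · rintro σ ⟨hσ1, hσ2⟩
    simp [hσ1, hσ2]

/-- If an algebra `B` over `M_n(F)` satisfies the Cayley-Hamilton identity, then the centralizer of
`M_n(F)` in `B` is commutative. -/
theorem commute_of_cayleyHamilton (hn : 2 ≤ n) (ψ : Matrix (Fin n) (Fin n) F →ₐ[F] B)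
    (w : (σ : Equiv.Perm (Fin (n + 1))) → CycleNotation σ)
    (hQ : ∀ r : Fin n → B,
      ∑ σ, ((Equiv.Perm.sign σ : ℤˣ) : ℤ) • phiValue ψ r (w σ) = 0)
    {a b : B} (ha : ∀ M, Commute a (ψ M)) (hb : ∀ M, Commute b (ψ M)) : a * b = b * a := by
  let i : Fin n := ⟨0, by omega⟩
  let j : Fin n := ⟨1, by omega⟩
  have hij : i ≠ j := by simp [i, j]
  let d : Fin n → B := fun k => if k = i then a else if k = j then b else 1
  have hd : ∀ k M, Commute (d k) (ψ M) := by
    intro k M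
    simp only [d]
    split_ifs
    exacts [ha M, hb M, Commute.one_left _]
  have hd1 : ∀ k, k ≠ i → k ≠ j → d k = 1 := fun k h1 h2 => by simp [d, h1, h2]
  have hlast : ∀ k : Fin n, Fin.last n ≠ k.castSucc := fun k => (Fin.castSucc_lt_last k).ne'
  have hcast : ∀ {k l : Fin n}, k ≠ l → k.castSucc ≠ l.castSucc := fun h h' =>
    h (Fin.castSucc_injective n h')
  -- the same transposition `s = (i j)` is used for both entries `(i, i)` and `(j, j)`
  have e : ∀ k l : Fin n, k ≠ l → (∀ m, m ≠ k → m ≠ l → d m = 1) →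
      (((w (Equiv.swap k.castSucc l.castSucc)).cycles.flatten ++
        (w (Equiv.swap k.castSucc l.castSucc)).last).map d).prod = d k * d l := by
    intro k l hkl h
    rw [← prod_map_eq_of_cayleyHamilton ψ w hQ hkl d hd rfl rfl]
    refine CycleNotation.prod_map_of_threeCycle hkl _ ?_ ?_ d h
    · rw [Equiv.Perm.mul_apply, Equiv.swap_apply_of_ne_of_ne (hlast k) (hlast l),
        Equiv.swap_apply_right]
    · rw [Equiv.Perm.mul_apply, Equiv.swap_apply_left,
        Equiv.swap_apply_of_ne_of_ne (hcast hkl.symm) (hlast l).symm]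
  have h1 := e i j hij hd1
  have h2 := e j i hij.symm fun k h h' => hd1 k h' h
  rw [Equiv.swap_comm, h1] at h2
  simpa [d, hij.symm] using h2

end Centralizer

/-! ### Reduction to polynomials in commuting variables -/

section Generic

open scoped TensorProduct

variable {n : ℕ} {F : Type u} [Field F]

/-- The evaluation of generalized polynomials at generic matrices. -/
noncomputable def genericEval (n : ℕ) (F : Type u) [Field F] :
    GenPoly n F →ₐ[F] Matrix (Fin n) (Fin n) (MvPolynomial (ℕ × Fin n × Fin n) F) :=
  aeval (Algebra.ofId F (MvPolynomial (ℕ × Fin n × Fin n) F)).mapMatrix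
    fun k => Matrix.of fun i j => MvPolynomial.X (k, i, j)

/-- The entries of `f` at generic matrices are polynomials that vanish at all points. -/
theorem genericEval_eq_zero [Infinite F] {f : GenPoly n F} (hf : IsGPI f) :
    genericEval n F f = 0 := by
  ext1 i j
  refine MvPolynomial.funext fun v => ?_
  have h : ((MvPolynomial.aeval v : MvPolynomial (ℕ × Fin n × Fin n) F →ₐ[F] F).mapMatrix).comp
      (genericEval n F) = eval fun k => Matrix.of fun i j => v (k, i, j) := by
    refine algHom_ext (fun M => ?_) fun k => ?_
    · ext i j
      simp [genericEval, eval, aeval_const, Algebra.ofId_apply]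
    · ext i j
      simp [genericEval, eval, aeval_x]
  have h' := congrFun (congrFun (DFunLike.congr_fun h f) i) j
  rw [hf] at h'
  simpa [MvPolynomial.aeval_def, MvPolynomial.eval₂_eq_eval_map] using h'

/-- The `(i, j)` entry `∑ e_{pi} y e_{jp}` of an element `y` of an algebra over `M_n(F)`. -/
noncomputable def entry {B : Type u} [Ring B] [Algebra F B]
    (ψ : Matrix (Fin n) (Fin n) F →ₐ[F] B) (i j : Fin n) (y : B) : B :=
  ∑ p, ψ (Matrix.single p i 1) * y * ψ (Matrix.single j p 1)

variable {B : Type u} [Ring B] [Algebra F B]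

theorem commute_entry (ψ : Matrix (Fin n) (Fin n) F →ₐ[F] B) (i j : Fin n) (y : B)
    (M : Matrix (Fin n) (Fin n) F) : Commute (entry ψ i j y) (ψ M) := by
  rw [Matrix.matrix_eq_sum_single M, map_sum]
  refine Commute.sum_right _ _ _ fun k _ => ?_
  rw [map_sum]
  refine Commute.sum_right _ _ _ fun l _ => ?_
  rw [← mul_one (M k l), ← smul_eq_mul, ← Matrix.smul_single, map_smul]
  refine Commute.smul_right ?_ _
  rw [Commute, SemiconjBy, entry, Finset.sum_mul, Finset.mul_sum,
    Finset.sum_eq_single k, Finset.sum_eq_single l]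
  · simp [mul_assoc, ← map_mul]
    simp [← mul_assoc, ← map_mul]
  · intro p _ hp
    rw [← mul_assoc, ← mul_assoc, ← map_mul, Matrix.single_mul_single_of_ne _ _ _ _ hp.symm]
    simp
  · simp
  · intro p _ hp
    rw [mul_assoc, ← map_mul, Matrix.single_mul_single_of_ne _ _ _ _ hp]
    simp
  · simp

/-- Every element of an algebra over `M_n(F)` is the matrix of its entries. -/
theorem sum_single_mul_entry (ψ : Matrix (Fin n) (Fin n) F →ₐ[F] B) (y : B) :
    ∑ i, ∑ j, entry ψ i j y * ψ (Matrix.single i j 1) = y := by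
  have h1 : ∀ i j, entry ψ i j y * ψ (Matrix.single i j 1) =
      ψ (Matrix.single i i 1) * y * ψ (Matrix.single j j 1) := by
    intro i j
    rw [entry, Finset.sum_mul, Finset.sum_eq_single i]
    · simp [mul_assoc, ← map_mul]
    · intro p _ hp
      rw [mul_assoc, ← map_mul, Matrix.single_mul_single_of_ne _ _ _ _ hp]
      simp
    · simp
  simp only [h1]
  simp only [← Finset.mul_sum, ← Finset.sum_mul, ← map_sum, Matrix.sum_single_one, map_one,
    one_mul, mul_one]

/-- If the centralizer of `M_n(F)` in `B` is commutative, then homomorphisms of `M_n(F) * F⟨X⟩`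
into `B` factor through generic matrices. -/
theorem exists_comp_genericEval (π : GenPoly n F →ₐ[F] B)
    (hB : ∀ a b : B, (∀ M, Commute a (π (const n F M))) → (∀ M, Commute b (π (const n F M))) →
      a * b = b * a) :
    ∃ Θ : Matrix (Fin n) (Fin n) (MvPolynomial (ℕ × Fin n × Fin n) F) →ₐ[F] B,
      Θ.comp (genericEval n F) = π := by
  let ψ := π.comp (const n F)
  -- `B` receives `F[y_{kij}]`, through its commutative subalgebra `C`, and `M_n(F)`; they commute
  let C : Subalgebra F B := Subalgebra.centralizer F (Set.range ψ)
  have hC : ∀ {a : B}, a ∈ C ↔ ∀ M, Commute a (ψ M) := by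
    intro a
    simp only [C, Subalgebra.mem_centralizer_iff, Set.forall_mem_range]
    exact forall_congr' fun M => ⟨fun h => h.symm, fun h => h.symm⟩
  let _ : CommRing C :=
    { (inferInstance : Ring C) with
      mul_comm := fun a b => Subtype.ext (hB a b (hC.1 a.2) (hC.1 b.2)) }
  let θ : MvPolynomial (ℕ × Fin n × Fin n) F →ₐ[F] C := MvPolynomial.aeval fun v =>
    ⟨entry ψ v.2.1 v.2.2 (π (x n F v.1)), hC.2 (commute_entry ψ _ _ _)⟩
  obtain ⟨L, hL⟩ : ∃ L : MvPolynomial (ℕ × Fin n × Fin n) F ⊗[F] Matrix (Fin n) (Fin n) F →ₐ[F] B,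
      ∀ a M, L (a ⊗ₜ[F] M) = θ a * ψ M :=
    ⟨Algebra.TensorProduct.lift (C.val.comp θ) ψ fun a M => hC.1 (θ a).2 M,
      fun a M => Algebra.TensorProduct.lift_tmul _ _ _ a M⟩
  refine ⟨L.comp (matrixEquivTensor (Fin n) F (MvPolynomial (ℕ × Fin n × Fin n) F)).toAlgHom,
    algHom_ext (fun M => ?_) fun k => ?_⟩
  · have h1 : genericEval n F (const n F M) =
        M.map (algebraMap F (MvPolynomial (ℕ × Fin n × Fin n) F)) := by
      rw [genericEval, aeval_const]
      rfl
    have h2 : matrixEquivTensor (Fin n) F (MvPolynomial (ℕ × Fin n × Fin n) F)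
        (M.map (algebraMap F (MvPolynomial (ℕ × Fin n × Fin n) F))) = 1 ⊗ₜ[F] M :=
      MatrixEquivTensor.invFun_algebraMap (Fin n) F _ M
    rw [AlgHom.comp_apply, h1]
    refine (congrArg L h2).trans ?_
    rw [hL, map_one, OneMemClass.coe_one, one_mul, AlgHom.comp_apply]
  · have h1 : genericEval n F (x n F k) = Matrix.of fun i j => MvPolynomial.X (k, i, j) :=
      aeval_x _ _ k
    rw [AlgHom.comp_apply, h1]
    refine (congrArg L (matrixEquivTensor_apply (Fin n) F _ _)).trans ?_
    rw [map_sum, Fintype.sum_prod_type]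
    refine Eq.trans ?_ (sum_single_mul_entry ψ (π (x n F k)))
    refine Finset.sum_congr rfl fun i _ => Finset.sum_congr rfl fun j _ => ?_
    rw [hL]
    simp [θ]

end Generic
end GPI

theorem mainTheorem5 (n : ℕ) (hn : 2 ≤ n) (F : Type u) [Field F] [CharZero F]
    (w : (σ : Equiv.Perm (Fin (n + 1))) → GPI.CycleNotation σ) :
    GPI.IsTIdeal (GPI.gpiIdeal n F) ∧
      GPI.tIdealSpan {GPI.cayleyHamilton F w} = GPI.gpiIdeal n F := by
  refine ⟨GPI.isTIdeal_gpiIdeal, le_antisymm (sInf_le ⟨GPI.isTIdeal_gpiIdeal, ?_⟩)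
    (le_sInf ?_)⟩
  · rintro f rfl
    exact (GPI.mem_gpiIdeal _).2 (GPI.isGPI_cayleyHamilton w)
  · rintro I ⟨hI, hQ⟩ f hf
    have hQ := hI _ (hQ _ rfl)
    -- the quotient map by `I`
    let π : GPI.GenPoly n F →ₐ[F] I.ringCon.Quotient :=
      { I.ringCon.mk' with commutes' := fun _ => rfl }
    have hπ : ∀ f, π f = 0 ↔ f ∈ I := by
      intro f
      rw [TwoSidedIdeal.mem_iff]
      exact I.ringCon.eq
    have hsurj : Function.Surjective π := I.ringCon.mk'_surjective
    obtain ⟨Θ, hΘ⟩ := GPI.exists_comp_genericEval (B := I.ringCon.Quotient) π fun a b ha hb => by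
      refine GPI.commute_of_cayleyHamilton hn (π.comp (GPI.const n F)) w (fun r => ?_) ha hb
      -- the `r i` lift to generalized polynomials, which are substituted into `Q_n`
      choose g hg using fun k : ℕ => hsurj (if h : k < n then r ⟨k, h⟩ else 0)
      have := (GPI.map_subst (B := I.ringCon.Quotient) π g _).symm.trans ((hπ _).2 (hQ g))
      rw [GPI.aeval_cayleyHamilton] at this
      simpa [hg] using this
    rw [← hπ, ← hΘ, AlgHom.comp_apply,
      GPI.genericEval_eq_zero ((GPI.mem_gpiIdeal f).1 hf), map_zero]
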